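/- Let $\mathcal D\subseteq\mathbb R^n$ be open and convex, let $f:\mathcal D\to\mathbb R$ be convex, let $X\subseteq\mathbb R^n$ be closed and convex, and let $\epsilon>0$ be such that $$X_\epsilon=\{x+z:\ x\in X,\ z\in\mathbb R^n,\ \|z\|\le\epsilon\}\subseteq\mathcal D ,$$ where $\|\cdot\|$ is the Euclidean norm. For $x\in\mathcal D$ let $\partial f(x)$ be the set of all $g\in\mathbb R^n$ with $f(x)+g^T(y-x)\le f(y)$ for all $y\in\mathcal D$. Assume that there is a constant $C>0$ with $\|g\|\le C$ for all $g\in\partial f(x)$ and all $x\in X_\epsilon$. Let $(\gamma_k)_{k\ge0}$ be deterministic steplengths with $\gamma_k>0$, $\sum_{k}\gamma_k=\infty$ and $\sum_{k}\gamma_k^2<\infty$. For $x\in X$ let $\hat f(x)=\mathbb E[f(x+z)]$, where $z$ is uniformly distributed on the ball $\{z\in\mathbb R^n:\|z\|\le\epsilon\}$, and assume that the problem $\min_{x\in X}\hat f(x)$ has an optimal solution. Let $x_0$ be a random vector with $x_0\in X$ almost surely and $\mathbb E\|x_0\|^2<\infty$, and let $z_0,z_1,\dots$ be i.i.d. random vectors,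 uniformly distributed on the ball $\{\|z\|\le\epsilon\}$, such that the sequence $(z_k)_{k\ge0}$ is independent of $x_0$. Suppose that, almost surely, for all $k\ge0$, $$x_{k+1}=\Pi_X\bigl(x_k-\gamma_k g_k\bigr),\qquad g_k\in\partial f(x_k+z_k),$$ where $\Pi_X$ is the Euclidean projection on $X$. Then there is a random vector $\bar x$ such that, almost surely, $\bar x\in X$, $\hat f(\bar x)=\min_{x\in X}\hat f(x)$, and $x_k\to\bar x$ as $k\to\infty$. -/

import Mathlib

open MeasureTheory ProbabilityTheory Filter Topology
open scoped Pointwise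

/-- The `ε`-enlargement `X_ε = {x + z : x ∈ X, ‖z‖ ≤ ε}` of a set `X ⊆ ℝⁿ`. -/
def enlargement {n : ℕ} (X : Set (EuclideanSpace ℝ (Fin n))) (ε : ℝ) :
    Set (EuclideanSpace ℝ (Fin n)) :=
  {y | ∃ x ∈ X, ∃ z : EuclideanSpace ℝ (Fin n), ‖z‖ ≤ ε ∧ y = x + z}

/-- The subdifferential at `x` of a function `f` whose domain is `D`: the set of all `g` with
`f x + ⟨g, y - x⟩ ≤ f y` for all `y ∈ D`. It is empty when `x ∉ D`. Values of `f` outside `D`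
play no role. -/
def subdifferential {n : ℕ} (D : Set (EuclideanSpace ℝ (Fin n)))
    (f : EuclideanSpace ℝ (Fin n) → ℝ) (x : EuclideanSpace ℝ (Fin n)) :
    Set (EuclideanSpace ℝ (Fin n)) :=
  {g | x ∈ D ∧ ∀ y ∈ D, f x + inner ℝ g (y - x) ≤ f y}

/-- `q` is the Euclidean projection of `p` on `X`. -/
def IsEuclideanProjection {n : ℕ} (X : Set (EuclideanSpace ℝ (Fin n)))
    (p q : EuclideanSpace ℝ (Fin n)) : Prop :=
  q ∈ X ∧ ∀ y ∈ X, ‖p - q‖ ≤ ‖p - y‖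

/-- The uniform distribution on the closed ball of radius `ε` around the origin of `ℝⁿ`:
normalized Lebesgue measure on that ball. -/
noncomputable def uniformBall (n : ℕ) (ε : ℝ) : Measure (EuclideanSpace ℝ (Fin n)) :=
  ProbabilityTheory.cond volume (Metric.closedBall 0 ε)

/-- The local smoothing `f̂ x = 𝔼[f (x + z)]`, with `z` uniform on the ball of radius `ε`. -/
noncomputable def localSmoothing {n : ℕ} (ε : ℝ) (f : EuclideanSpace ℝ (Fin n) → ℝ)
    (x : EuclideanSpace ℝ (Fin n)) : ℝ :=
  ∫ z, f (x + z) ∂(uniformBall n ε)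

/-- `x` is an optimal solution of the problem of minimizing `h` over `X`. -/
def IsOptimalSolution {n : ℕ} (X : Set (EuclideanSpace ℝ (Fin n)))
    (h : EuclideanSpace ℝ (Fin n) → ℝ) (x : EuclideanSpace ℝ (Fin n)) : Prop :=
  x ∈ X ∧ ∀ y ∈ X, h x ≤ h y

/-- The expectation defining the smoothing at a point of `X` is that of an integrable function
whenever `f` is convex on an open set that contains the `ε`-enlargement of `X`. -/
theorem integrable_localSmoothing {n : ℕ} {D X : Set (EuclideanSpace ℝ (Fin n))} {ε : ℝ}
    {f : EuclideanSpace ℝ (Fin n) → ℝ} (hD : IsOpen D) (hf : ConvexOn ℝ D f)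
    (hXD : enlargement X ε ⊆ D) {x : EuclideanSpace ℝ (Fin n)} (hx : x ∈ X) :
    Integrable (fun z => f (x + z)) (uniformBall n ε) := by
  have hc : ContinuousOn (fun z => f (x + z)) (Metric.closedBall 0 ε) := by
    refine (hf.continuousOn hD).comp (by fun_prop) ?_
    intro z hz
    exact hXD ⟨x, hx, z, by simpa using hz, rfl⟩
  have hi : IntegrableOn (fun z => f (x + z)) (Metric.closedBall 0 ε) volume :=
    hc.integrableOn_compact (isCompact_closedBall _ _)
  rcases lt_or_ge 0 ε with hε | hε
  · exact Integrable.smul_measure hi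
      (ENNReal.inv_ne_top.2 (Metric.measure_closedBall_pos _ _ hε).ne')
  · by_cases h0 : (volume (Metric.closedBall (0 : EuclideanSpace ℝ (Fin n)) ε)) = 0
    · simp [uniformBall, ProbabilityTheory.cond, Measure.restrict_eq_zero.2 h0]
    · exact Integrable.smul_measure hi (ENNReal.inv_ne_top.2 h0)

/-! A convex `f` is differentiable almost everywhere on `D`. Since `z k` has a density and is
independent of the past, the sampled point is almost surely a point of differentiability, where the
gradient is the only subgradient. Measurability of the `g k` and of the later `x k` is not given, so
the analysis runs on `projectedProcess`: it is driven by the measurable field `boundedGradient`,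
stays surely in `X`, and almost surely coincides with `x`.

Let y be this process, G its field and a a minimizer. Nonexpansiveness of the projection gives
‖y_{k+1} - a‖² ≤ ‖y_k - a‖² - 2γ_k⟨G(y_k + z_k), y_k - a⟩ + C²γ_k². Averaged over z_k, the inner
product dominates the gap f̂(y_k) - f̂(a) (`localSmoothing_sub_le`). Supermartingale convergence
(`ae_tendsto_and_bddAbove_of_setIntegral_le`) then yields convergence of ‖y_k - a‖ and boundedness
of the weighted gap sums.

As the steps are not summable, the gaps come arbitrarily close to 0, so some cluster point is a
minimizer, and convergent distances force the whole sequence to it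
(`exists_isOptimalSolution_tendsto`). The exceptional null set depends on a, so distances are
controlled only for a countable dense set of minimizers. -/

/-! ### Differentiability of convex functions -/

section Convex

variable {E : Type*} [NormedAddCommGroup E] [InnerProductSpace ℝ E]

/-- The gradient inequality for a convex function at a point of differentiability. -/
theorem ConvexOn.add_fderiv_le {D : Set E} {f : E → ℝ} (hf : ConvexOn ℝ D f) {x y : E}
    (hx : x ∈ D) (hy : y ∈ D) (hd : DifferentiableAt ℝ f x) :
    f x + fderiv ℝ f x (y - x) ≤ f y := by
  have hline : HasDerivAt (fun t : ℝ => f (AffineMap.lineMap x y t)) (fderiv ℝ f x (y - x)) 0 := by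
    have h1 : HasDerivAt (fun t : ℝ => AffineMap.lineMap x y t) (y - x) 0 :=
      AffineMap.hasDerivAt_lineMap
    have h2 : HasFDerivAt f (fderiv ℝ f x) (AffineMap.lineMap x y (0 : ℝ)) := by
      simpa using hd.hasFDerivAt
    exact h2.comp_hasDerivAt 0 h1
  have hconv : ConvexOn ℝ (AffineMap.lineMap x y ⁻¹' D) (f ∘ AffineMap.lineMap (k := ℝ) x y) :=
    hf.comp_affineMap _
  have h := hconv.le_slope_of_hasDerivAt (x := 0) (y := 1) (by simpa using hx) (by simpa using hy)
    one_pos hline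
  simp only [slope_def_field, Function.comp_apply, AffineMap.lineMap_apply_one,
    AffineMap.lineMap_apply_zero, sub_zero, div_one] at h
  linarith

/-- A convex function on an open subset of a finite-dimensional space is differentiable almost
everywhere. -/
theorem ConvexOn.ae_differentiableAt [FiniteDimensional ℝ E] [MeasurableSpace E] [BorelSpace E]
    {μ : Measure E} [μ.IsAddHaarMeasure] {D : Set E} {f : E → ℝ} (hD : IsOpen D)
    (hf : ConvexOn ℝ D f) : ∀ᵐ x ∂μ, x ∈ D → DifferentiableAt ℝ f x := by
  have : μ {x | x ∈ D ∧ ¬ DifferentiableAt ℝ f x} = 0 := by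
    refine measure_null_of_locally_null _ fun x hx => ?_
    obtain ⟨K, t, ht, hK⟩ := hf.locallyLipschitzOn hD hx.1
    rw [hD.nhdsWithin_eq hx.1] at ht
    refine ⟨interior t ∩ {x | ¬ DifferentiableAt ℝ f x}, ?_, ?_⟩
    · refine mem_nhdsWithin.2 ⟨interior t, isOpen_interior, mem_interior_iff_mem_nhds.2 ht, ?_⟩
      exact fun y hy => ⟨hy.1, hy.2.2⟩
    -- Rademacher's theorem on a neighbourhood where `f` is Lipschitz.
    · have h := hK.ae_differentiableWithinAt_of_mem (μ := μ)
      refine measure_mono_null ?_ (ae_iff.1 h)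
      intro y hy
      simp only [Set.mem_ofPred_eq, Classical.not_imp]
      exact ⟨interior_subset hy.1, fun h' =>
        hy.2 (h'.differentiableAt (mem_interior_iff_mem_nhds.1 hy.1))⟩
  rw [ae_iff]
  simpa only [Classical.not_imp] using this

end Convex

/-! ### Euclidean projection -/

section Projection

variable {n : ℕ}

local notation "E" => EuclideanSpace ℝ (Fin n)

theorem IsEuclideanProjection.inner_le_zero {X : Set E} (hX : Convex ℝ X) {p q : E}
    (h : IsEuclideanProjection X p q) {w : E} (hw : w ∈ X) : inner ℝ (p - q) (w - q) ≤ 0 := by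
  refine (norm_eq_iInf_iff_real_inner_le_zero hX h.1).1 ?_ w hw
  have : Nonempty X := ⟨⟨q, h.1⟩⟩
  refine le_antisymm (le_ciInf fun y => h.2 y y.2) ?_
  exact ciInf_le (f := fun w : X => ‖p - w‖) ⟨0, by rintro _ ⟨y, rfl⟩; positivity⟩ ⟨q, h.1⟩

/-- Projection onto a convex set is nonexpansive. -/
theorem IsEuclideanProjection.norm_sub_le {X : Set E} (hX : Convex ℝ X) {p q p' q' : E}
    (h : IsEuclideanProjection X p q) (h' : IsEuclideanProjection X p' q') :
    ‖q - q'‖ ≤ ‖p - p'‖ := by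
  have h1 := h.inner_le_zero hX h'.1
  have h2 := h'.inner_le_zero hX h.1
  have h3 : ‖q - q'‖ * ‖q - q'‖ ≤ inner ℝ (p - p') (q - q') := by
    rw [← real_inner_self_eq_norm_mul_norm]
    have e1 : inner ℝ (p - q) (q' - q) = - inner ℝ (p - q) (q - q') := by
      rw [← inner_neg_right, neg_sub]
    have e2 : inner ℝ (p - p') (q - q') - inner ℝ (q - q') (q - q')
      = inner ℝ (p - q) (q - q') - inner ℝ (p' - q') (q - q') := by
      simp only [← inner_sub_left]; congr 1; abel
    linarith
  have h4 := h3.trans (real_inner_le_norm _ _)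
  rcases (norm_nonneg (q - q')).eq_or_lt with h0 | h0
  · rw [← h0]; positivity
  · exact le_of_mul_le_mul_right h4 h0

theorem IsEuclideanProjection.self {X : Set E} {p : E} (hp : p ∈ X) :
    IsEuclideanProjection X p p := ⟨hp, fun y _ => by simp⟩

theorem IsEuclideanProjection.unique {X : Set E} (hX : Convex ℝ X) {p q q' : E}
    (h : IsEuclideanProjection X p q) (h' : IsEuclideanProjection X p q') : q = q' := by
  have := h.norm_sub_le hX h'
  rw [sub_self, norm_zero] at this
  exact sub_eq_zero.1 (norm_le_zero_iff.1 this)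

theorem exists_isEuclideanProjection {X : Set E} (hX : IsClosed X) (hne : X.Nonempty) (p : E) :
    ∃ q, IsEuclideanProjection X p q := by
  obtain ⟨q, hq, h⟩ := hX.exists_infDist_eq_dist hne p
  refine ⟨q, hq, fun y hy => ?_⟩
  rw [← dist_eq_norm, ← dist_eq_norm, ← h]
  exact Metric.infDist_le_dist_of_mem hy

end Projection

/-! ### Deterministic convergence by Fejér monotonicity -/

section Fejer

/-- A sequence whose distance to every solution converges, and along which the weighted sums of
the objective gaps stay bounded for nonsummable weights, converges to a solution. -/
theorem exists_isOptimalSolution_tendsto {n : ℕ} {X S : Set (EuclideanSpace ℝ (Fin n))}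
    {h : EuclideanSpace ℝ (Fin n) → ℝ} (hX : IsClosed X) (hh : ContinuousOn h X)
    {γ : ℕ → ℝ} (hγ : ∀ k, 0 < γ k) (hγsum : ¬ Summable γ)
    {a : EuclideanSpace ℝ (Fin n)} (ha : IsOptimalSolution X h a)
    {y : ℕ → EuclideanSpace ℝ (Fin n)} (hy : ∀ k, y k ∈ X)
    {B : ℝ} (hB : ∀ k, ∑ i ∈ Finset.range k, γ i * (h (y i) - h a) ≤ B)
    (hS : ∀ b, IsOptimalSolution X h b → b ∈ closure S)
    (hlim : ∀ s ∈ S, ∃ l, Tendsto (fun k => ‖y k - s‖) atTop (𝓝 l)) :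
    ∃ b, IsOptimalSolution X h b ∧ Tendsto y atTop (𝓝 b) := by
  have hnn : ∀ k, 0 ≤ h (y k) - h a := fun k => sub_nonneg.2 (ha.2 _ (hy k))
  have hsm : Summable fun k => γ k * (h (y k) - h a) :=
    summable_of_sum_range_le (fun k => mul_nonneg (hγ k).le (hnn k)) hB
  -- Otherwise `γ k` is eventually at most `m + 1` times the `k`-th term of `hsm`, which would make
  -- `γ` summable.
  have hfreq : ∀ m : ℕ, ∃ᶠ k in atTop, h (y k) - h a < 1 / ((m : ℝ) + 1) := by
    intro m hev
    refine hγsum (Summable.of_norm_bounded_eventually_nat (hsm.mul_left ((m : ℝ) + 1)) ?_)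
    filter_upwards [hev] with k hk
    rw [Real.norm_of_nonneg (hγ k).le]
    have hm : (0 : ℝ) < m + 1 := by positivity
    have h1 : 1 ≤ (m + 1) * (h (y k) - h a) := by
      have := not_lt.1 hk
      rwa [div_le_iff₀' hm] at this
    nlinarith [hγ k]
  obtain ⟨φ, hφ, hφlt⟩ := extraction_forall_of_frequently hfreq
  obtain ⟨s₀, hs₀⟩ : S.Nonempty := closure_nonempty_iff.1 ⟨a, hS a ha⟩
  obtain ⟨l₀, hl₀⟩ := hlim s₀ hs₀
  obtain ⟨R, hR⟩ := hl₀.bddAbove_range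
  have hyR : ∀ k, y (φ k) ∈ Metric.closedBall s₀ R := fun k => by
    rw [Metric.mem_closedBall, dist_eq_norm]
    exact hR ⟨φ k, rfl⟩
  obtain ⟨b, -, ψ, hψ, hb⟩ := tendsto_subseq_of_bounded Metric.isBounded_closedBall hyR
  have hbX : b ∈ X := hX.mem_of_tendsto hb (Eventually.of_forall fun k => hy _)
  have hhb : Tendsto (fun k => h (y (φ (ψ k)))) atTop (𝓝 (h b)) :=
    (hh b hbX).tendsto.comp
      (tendsto_nhdsWithin_iff.2 ⟨hb, Eventually.of_forall fun k => hy _⟩)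
  have hba : h b ≤ h a := by
    have h1 : Tendsto (fun k => h a + 1 / (((ψ k : ℕ) : ℝ) + 1)) atTop (𝓝 (h a + 0)) :=
      (tendsto_one_div_add_atTop_nhds_zero_nat.comp hψ.tendsto_atTop).const_add _
    rw [add_zero] at h1
    refine le_of_tendsto_of_tendsto' hhb h1 fun k => ?_
    linarith [hφlt (ψ k)]
  have hbopt : IsOptimalSolution X h b := ⟨hbX, fun w hw => hba.trans (ha.2 w hw)⟩
  refine ⟨b, hbopt, ?_⟩
  rw [Metric.tendsto_nhds]
  intro δ hδ
  -- The distance to `b` itself is not known to converge. A nearby `s ∈ S` replaces it; the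
  -- subsequence identifies the limiting distance to `s` as `‖b - s‖`.
  obtain ⟨s, hs, hbs⟩ := Metric.mem_closure_iff.1 (hS b hbopt) (δ / 2) (half_pos hδ)
  obtain ⟨l, hl⟩ := hlim s hs
  have hl' : Tendsto (fun k => ‖y (φ (ψ k)) - s‖) atTop (𝓝 ‖b - s‖) :=
    (hb.sub_const s).norm
  have hll : l = ‖b - s‖ :=
    tendsto_nhds_unique ((hl.comp hφ.tendsto_atTop).comp hψ.tendsto_atTop) hl'
  rw [dist_eq_norm] at hbs
  filter_upwards [hl.eventually_lt_const (hll ▸ hbs)] with k hk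
  calc dist (y k) b ≤ dist (y k) s + dist s b := dist_triangle _ _ _
    _ < δ / 2 + δ / 2 := by
      rw [dist_eq_norm, dist_comm, dist_eq_norm]; exact add_lt_add hk hbs
    _ = δ := add_halves δ

end Fejer

/-! ### Subgradients and a measurable gradient field -/

section Gradient

variable {n : ℕ}

local notation "E" => EuclideanSpace ℝ (Fin n)

theorem inner_gradient_eq_fderiv (f : E → ℝ) (p v : E) :
    inner ℝ (gradient f p) v = fderiv ℝ f p v := by
  rw [← toDual_gradient, InnerProductSpace.toDual_apply_apply]

theorem gradient_mem_subdifferential {D : Set E} {f : E → ℝ} (hf : ConvexOn ℝ D f) {p : E}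
    (hp : p ∈ D) (hd : DifferentiableAt ℝ f p) : gradient f p ∈ subdifferential D f p :=
  ⟨hp, fun y hy => by rw [inner_gradient_eq_fderiv]; exact hf.add_fderiv_le hp hy hd⟩

/-- Subtracting the linear function of slope `g` from `f` leaves a local minimum at `p`, so the
derivative of the difference vanishes. This removes the freedom in the choice of subgradients. -/
theorem eq_gradient_of_mem_subdifferential {D : Set E} (hD : IsOpen D) {f : E → ℝ} {p g : E}
    (hd : DifferentiableAt ℝ f p) (hg : g ∈ subdifferential D f p) : g = gradient f p := by
  have hmin : IsLocalMin (fun y => f y - inner ℝ g y) p := by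
    filter_upwards [hD.mem_nhds hg.1] with y hy
    have := hg.2 y hy
    rw [inner_sub_right] at this
    linarith
  have hder : HasFDerivAt (fun y => f y - inner ℝ g y) (fderiv ℝ f p - innerSL ℝ g) p :=
    hd.hasFDerivAt.sub (innerSL ℝ g).hasFDerivAt
  have h0 := hmin.hasFDerivAt_eq_zero hder
  refine ext_inner_right ℝ fun v => ?_
  have := congrArg (fun l => l v) h0
  simp only [sub_apply, innerSL_apply_apply, zero_apply]
    at this
  rw [inner_gradient_eq_fderiv]
  linarith

theorem measurable_gradient (f : E → ℝ) : Measurable (gradient f) :=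
  (InnerProductSpace.toDual ℝ E).symm.continuous.measurable.comp (measurable_fderiv ℝ f)

/-- The points of `D` at which `f` has a gradient of norm at most `C`. -/
def boundedGradientPoints (D : Set E) (f : E → ℝ) (C : ℝ) : Set E :=
  {p | p ∈ D ∧ DifferentiableAt ℝ f p ∧ ‖gradient f p‖ ≤ C}

/-- The gradient of `f` where it exists in `D` with norm at most `C`, and zero elsewhere. -/
noncomputable def boundedGradient (D : Set E) (f : E → ℝ) (C : ℝ) : E → E :=
  (boundedGradientPoints D f C).indicator (gradient f)

theorem measurableSet_boundedGradientPoints {D : Set E} (hD : IsOpen D) (f : E → ℝ) (C : ℝ) :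
    MeasurableSet (boundedGradientPoints D f C) :=
  hD.measurableSet.inter ((measurableSet_of_differentiableAt ℝ f).inter
    (measurableSet_le (measurable_gradient f).norm measurable_const))

theorem measurable_boundedGradient {D : Set E} (hD : IsOpen D) (f : E → ℝ) (C : ℝ) :
    Measurable (boundedGradient D f C) :=
  (measurable_gradient f).indicator (measurableSet_boundedGradientPoints hD f C)

theorem norm_boundedGradient_le {D : Set E} {f : E → ℝ} {C : ℝ} (hC : 0 ≤ C) (p : E) :
    ‖boundedGradient D f C p‖ ≤ C := by
  by_cases hp : p ∈ boundedGradientPoints D f C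
  · rw [boundedGradient, Set.indicator_of_mem hp]; exact hp.2.2
  · rw [boundedGradient, Set.indicator_of_notMem hp, norm_zero]; exact hC

theorem boundedGradient_mem_subdifferential {D : Set E} {f : E → ℝ} (hf : ConvexOn ℝ D f) {C : ℝ}
    {p : E} (hp : p ∈ boundedGradientPoints D f C) :
    boundedGradient D f C p ∈ subdifferential D f p := by
  rw [boundedGradient, Set.indicator_of_mem hp]
  exact gradient_mem_subdifferential hf hp.1 hp.2.1

theorem eq_boundedGradient {D : Set E} (hD : IsOpen D) {f : E → ℝ} {C : ℝ} {p g : E}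
    (hp : p ∈ boundedGradientPoints D f C) (hg : g ∈ subdifferential D f p) :
    g = boundedGradient D f C p := by
  rw [boundedGradient, Set.indicator_of_mem hp]
  exact eq_gradient_of_mem_subdifferential hD hp.2.1 hg

end Gradient

/-! ### The smoothed objective -/

section Smoothing

variable {n : ℕ}

local notation "E" => EuclideanSpace ℝ (Fin n)

theorem isProbabilityMeasure_uniformBall {ε : ℝ} (hε : 0 < ε) :
    IsProbabilityMeasure (uniformBall n ε) :=
  cond_isProbabilityMeasure_of_finite (Metric.measure_closedBall_pos _ _ hε).ne'
    measure_closedBall_lt_top.ne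

theorem ae_uniformBall_mem_closedBall (ε : ℝ) :
    ∀ᵐ z ∂uniformBall n ε, z ∈ Metric.closedBall (0 : E) ε :=
  ae_cond_mem Metric.isClosed_closedBall.measurableSet

/-- Translation preserves Lebesgue null sets and the uniform law is absolutely continuous, so
non-differentiability is avoided; the gradient is a subgradient, hence bounded by `C`. -/
theorem ae_add_mem_boundedGradientPoints {D X : Set E} {f : E → ℝ} {ε C : ℝ}
    (hD : IsOpen D) (hf : ConvexOn ℝ D f) (hXD : enlargement X ε ⊆ D)
    (hbdd : ∀ x ∈ enlargement X ε, ∀ g ∈ subdifferential D f x, ‖g‖ ≤ C) {x : E} (hx : x ∈ X) :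
    ∀ᵐ z ∂uniformBall n ε, x + z ∈ boundedGradientPoints D f C := by
  have hd : ∀ᵐ z ∂(volume : Measure E), x + z ∈ D → DifferentiableAt ℝ f (x + z) :=
    (measurePreserving_add_left volume x).quasiMeasurePreserving.ae
      (hf.ae_differentiableAt (μ := volume) hD)
  filter_upwards [cond_absolutelyContinuous.ae_le hd, ae_uniformBall_mem_closedBall ε]
    with z hz hzb
  have hmem : x + z ∈ enlargement X ε := ⟨x, hx, z, by simpa using hzb, rfl⟩
  have hdz := hz (hXD hmem)
  exact ⟨hXD hmem, hdz, hbdd _ hmem _ (gradient_mem_subdifferential hf (hXD hmem) hdz)⟩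

theorem measurable_inner_boundedGradient {D : Set E} (hD : IsOpen D) (f : E → ℝ) (C : ℝ) (b : E) :
    Measurable fun p : E × E => inner ℝ (boundedGradient D f C (p.1 + p.2)) (p.1 - b) :=
  ((measurable_boundedGradient hD f C).comp (measurable_fst.add measurable_snd)).inner
    (measurable_fst.sub_const b)

theorem integrable_inner_boundedGradient {D : Set E} (hD : IsOpen D) (f : E → ℝ) {ε C : ℝ}
    (hε : 0 < ε) (hC : 0 ≤ C) (x v : E) :
    Integrable (fun z => inner ℝ (boundedGradient D f C (x + z)) v) (uniformBall n ε) := by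
  have := isProbabilityMeasure_uniformBall (n := n) hε
  refine Integrable.of_bound (C := C * ‖v‖) ?_ (Eventually.of_forall fun z => ?_)
  · exact (((measurable_boundedGradient hD f C).comp (measurable_const_add x)).inner
      measurable_const).aestronglyMeasurable
  · exact (norm_inner_le_norm _ _).trans
      (mul_le_mul_of_nonneg_right (norm_boundedGradient_le hC _) (norm_nonneg _))

/-- Integrates over `z` the subgradient inequality between `x + z` and `y + z`. Thus the averaged
gradient acts as a subgradient of the smoothing relative to `X`. -/
theorem localSmoothing_sub_le {D X : Set E} {f : E → ℝ} {ε C : ℝ}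
    (hD : IsOpen D) (hf : ConvexOn ℝ D f) (hε : 0 < ε) (hXD : enlargement X ε ⊆ D) (hC : 0 ≤ C)
    (hbdd : ∀ x ∈ enlargement X ε, ∀ g ∈ subdifferential D f x, ‖g‖ ≤ C)
    {x y : E} (hx : x ∈ X) (hy : y ∈ X) :
    localSmoothing ε f x - localSmoothing ε f y
      ≤ ∫ z, inner ℝ (boundedGradient D f C (x + z)) (x - y) ∂uniformBall n ε := by
  have hix := integrable_localSmoothing hD hf hXD hx
  have hiy := integrable_localSmoothing hD hf hXD hy
  rw [localSmoothing, localSmoothing, ← integral_sub hix hiy]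
  refine integral_mono_ae (hix.sub hiy) (integrable_inner_boundedGradient hD f hε hC x _) ?_
  filter_upwards [ae_add_mem_boundedGradientPoints hD hf hXD hbdd hx,
    ae_uniformBall_mem_closedBall ε] with z hz hzb
  have h := (boundedGradient_mem_subdifferential hf hz).2 (y + z)
    (hXD ⟨y, hy, z, by simpa using hzb, rfl⟩)
  rw [add_sub_add_right_eq_sub, ← neg_sub x y, inner_neg_right] at h
  linarith

theorem localSmoothing_sub_le_mul_norm {D X : Set E} {f : E → ℝ} {ε C : ℝ}
    (hD : IsOpen D) (hf : ConvexOn ℝ D f) (hε : 0 < ε) (hXD : enlargement X ε ⊆ D) (hC : 0 ≤ C)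
    (hbdd : ∀ x ∈ enlargement X ε, ∀ g ∈ subdifferential D f x, ‖g‖ ≤ C)
    {x y : E} (hx : x ∈ X) (hy : y ∈ X) :
    localSmoothing ε f x - localSmoothing ε f y ≤ C * ‖x - y‖ := by
  have := isProbabilityMeasure_uniformBall (n := n) hε
  refine (localSmoothing_sub_le hD hf hε hXD hC hbdd hx hy).trans ?_
  refine (integral_mono (integrable_inner_boundedGradient hD f hε hC x _)
    (integrable_const (C * ‖x - y‖)) fun z => ?_).trans (by simp)
  exact (real_inner_le_norm _ _).trans
    (mul_le_mul_of_nonneg_right (norm_boundedGradient_le hC _) (norm_nonneg _))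

theorem lipschitzOnWith_localSmoothing {D X : Set E} {f : E → ℝ} {ε C : ℝ}
    (hD : IsOpen D) (hf : ConvexOn ℝ D f) (hε : 0 < ε) (hXD : enlargement X ε ⊆ D) (hC : 0 ≤ C)
    (hbdd : ∀ x ∈ enlargement X ε, ∀ g ∈ subdifferential D f x, ‖g‖ ≤ C) :
    LipschitzOnWith C.toNNReal (localSmoothing ε f) X := by
  refine LipschitzOnWith.of_le_add_mul _ fun x hx y hy => ?_
  rw [Real.coe_toNNReal _ hC, dist_eq_norm]
  linarith [localSmoothing_sub_le_mul_norm hD hf hε hXD hC hbdd hx hy]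

end Smoothing

/-! ### Supermartingale convergence -/

section Supermartingale

variable {Ω : Type*} {mΩ : MeasurableSpace Ω} {P : Measure Ω} [IsProbabilityMeasure P]

/-- A special case of the Robbins–Siegmund theorem, for deterministic perturbations. -/
theorem ae_tendsto_and_bddAbove_of_setIntegral_le {ℱ : Filtration ℕ mΩ} {V U : ℕ → Ω → ℝ}
    {β : ℕ → ℝ} (hVm : StronglyAdapted ℱ V) (hUm : StronglyAdapted ℱ U)
    (hV : ∀ k, Integrable (V k) P) (hU : ∀ k, Integrable (U k) P)
    (hV0 : ∀ k ω, 0 ≤ V k ω) (hU0 : ∀ k ω, 0 ≤ U k ω) (hβ0 : ∀ k, 0 ≤ β k) (hβ : Summable β)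
    (hle : ∀ k s, MeasurableSet[ℱ k] s →
      ∫ ω in s, V (k + 1) ω ∂P ≤ ∫ ω in s, (V k ω - U k ω + β k) ∂P) :
    ∀ᵐ ω ∂P, (∃ l, Tendsto (fun k => V k ω) atTop (𝓝 l)) ∧
      ∃ B, ∀ k, ∑ i ∈ Finset.range k, U i ω ≤ B := by
  -- Adding the past of `U` absorbs the decrease; adding the tail of `∑ β`, rather than subtracting
  -- its partial sums, keeps `W` nonnegative.
  set W : ℕ → Ω → ℝ := fun k ω =>
    V k ω + ∑ i ∈ Finset.range k, U i ω + (∑' i, β i - ∑ i ∈ Finset.range k, β i) with hWdef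
  have hWm : StronglyAdapted ℱ W := fun k =>
    ((hVm k).add (Finset.stronglyMeasurable_fun_sum _ fun i hi =>
      (hUm i).mono (ℱ.mono (Finset.mem_range.1 hi).le))).add stronglyMeasurable_const
  have hWi : ∀ k, Integrable (W k) P := fun k =>
    ((hV k).add (integrable_finsetSum _ fun i _ => hU i)).add (integrable_const _)
  have hW0 : ∀ k ω, 0 ≤ W k ω := fun k ω =>
    add_nonneg (add_nonneg (hV0 k ω) (Finset.sum_nonneg fun i _ => hU0 i ω))
      (sub_nonneg.2 (hβ.sum_le_tsum _ fun i _ => hβ0 i))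
  have hsuper : Supermartingale W ℱ P := by
    refine supermartingale_of_setIntegral_succ_le hWm hWi fun k s hs => ?_
    have hrest : Integrable (fun ω => W k ω - V k ω + U k ω - β k) P :=
      (((hWi k).sub (hV k)).add (hU k)).sub (integrable_const _)
    have hmid : Integrable (fun ω => V k ω - U k ω + β k) P :=
      ((hV k).sub (hU k)).add (integrable_const _)
    have e1 : ∀ ω, W (k + 1) ω = V (k + 1) ω + (W k ω - V k ω + U k ω - β k) := fun ω => by
      simp only [hWdef, Finset.sum_range_succ]; ring
    have e2 : ∀ ω, W k ω = (V k ω - U k ω + β k) + (W k ω - V k ω + U k ω - β k) :=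
      fun ω => by ring
    rw [integral_congr_ae (Eventually.of_forall e1), integral_congr_ae (Eventually.of_forall e2),
      integral_add (hV _).integrableOn hrest.integrableOn,
      integral_add hmid.integrableOn hrest.integrableOn]
    exact add_le_add_left (hle k s hs) _
  -- For a nonnegative supermartingale the L¹ norm is the mean, which never exceeds its initial
  -- value.
  have hbd : ∀ k, eLpNorm ((-W) k) 1 P ≤ ((∫ ω, W 0 ω ∂P).toNNReal : ENNReal) := fun k => by
    rw [Pi.neg_apply, eLpNorm_neg, eLpNorm_one_eq_lintegral_enorm,
      ← ofReal_integral_norm_eq_lintegral_enorm (hWi k)]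
    refine ENNReal.ofReal_le_ofReal ?_
    simp only [Real.norm_of_nonneg (hW0 _ _)]
    simpa using hsuper.setIntegral_le (Nat.zero_le k) MeasurableSet.univ
  filter_upwards [hsuper.neg.exists_ae_tendsto_of_bdd hbd] with ω ⟨c, hc⟩
  have hc' : Tendsto (fun k => W k ω) atTop (𝓝 (-c)) := by simpa using hc.neg
  obtain ⟨B, hB⟩ := hc'.bddAbove_range
  have hUB : ∀ k, ∑ i ∈ Finset.range k, U i ω ≤ B := fun k => by
    have h1 : W k ω ≤ B := hB ⟨k, rfl⟩
    have h2 := hβ.sum_le_tsum (Finset.range k) fun i _ => hβ0 i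
    have h3 := hV0 k ω
    simp only [hWdef] at h1
    linarith
  refine ⟨⟨-c - ∑' i, U i ω - (∑' i, β i - ∑' i, β i), ?_⟩, B, hUB⟩
  have hUs := (summable_of_sum_range_le (fun i => hU0 i ω) hUB).hasSum.tendsto_sum_nat
  refine ((hc'.sub hUs).sub (hβ.hasSum.tendsto_sum_nat.const_sub _)).congr fun k => ?_
  simp only [hWdef]; ring

end Supermartingale

/-! ### Integration against an independent sample -/

section Independence

variable {Ω : Type*} {m mΩ : MeasurableSpace Ω} {P : Measure Ω} [IsProbabilityMeasure P]

/-- Integrating out an independent variable over an event of the past. -/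
theorem setIntegral_comp_eq_of_indep {α γ : Type*} [MeasurableSpace α] [MeasurableSpace γ]
    (hm : m ≤ mΩ) {Y : Ω → α} {Z : Ω → γ} (hY : Measurable[m] Y)
    (hZ : Measurable Z) (hind : Indep m (MeasurableSpace.comap Z inferInstance) P)
    {F : α × γ → ℝ} (hF : Measurable F) (hFi : Integrable (fun ω => F (Y ω, Z ω)) P)
    {s : Set Ω} (hs : MeasurableSet[m] s) :
    ∫ ω in s, F (Y ω, Z ω) ∂P = ∫ ω in s, ∫ z, F (Y ω, z) ∂(P.map Z) ∂P := by
  have : IsProbabilityMeasure (P.map Z) := Measure.isProbabilityMeasure_map hZ.aemeasurable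
  -- Recording membership in `s` as a `Prop`-valued coordinate turns the integral over `s` into one
  -- over a product set, to which Fubini applies.
  have hUm : Measurable[m] fun ω => (Y ω, (ω ∈ s : Prop)) :=
    hY.prodMk ((@measurableSet_setOfPred _ m).1 hs)
  set U : Ω → α × Prop := fun ω => (Y ω, ω ∈ s)
  have hU : Measurable U := hUm.mono hm le_rfl
  have : IsProbabilityMeasure (P.map U) := Measure.isProbabilityMeasure_map hU.aemeasurable
  have hUZ : IndepFun U Z P := indep_of_indep_of_le_left hind hUm.comap_le
  have hlaw : P.map (fun ω => (U ω, Z ω)) = (P.map U).prod (P.map Z) :=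
    (indepFun_iff_map_prod_eq_prod_map_map hU.aemeasurable hZ.aemeasurable).1 hUZ
  have ht : MeasurableSet {p : α × Prop | p.2} := measurableSet_setOfPred.2 measurable_snd
  have hF' : Measurable fun q : (α × Prop) × γ => F (q.1.1, q.2) := by fun_prop
  have hint : Integrable (fun q : (α × Prop) × γ => F (q.1.1, q.2)) ((P.map U).prod (P.map Z)) := by
    rw [← hlaw, integrable_map_measure hF'.aestronglyMeasurable (hU.prodMk hZ).aemeasurable]
    exact hFi
  calc ∫ ω in s, F (Y ω, Z ω) ∂P
      = ∫ q in {p : α × Prop | p.2} ×ˢ Set.univ, F (q.1.1, q.2) ∂((P.map U).prod (P.map Z)) := by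
        rw [← hlaw, setIntegral_map (ht.prod MeasurableSet.univ) hF'.aestronglyMeasurable
          (hU.prodMk hZ).aemeasurable]
        congr 2
        ext ω; simp [U]
    _ = ∫ u in {p : α × Prop | p.2}, ∫ z, F (u.1, z) ∂(P.map Z) ∂(P.map U) := by
        rw [setIntegral_prod _ hint.integrableOn]; simp
    _ = ∫ ω in s, ∫ z, F (Y ω, z) ∂(P.map Z) ∂P := by
        have hsm : StronglyMeasurable fun u : α × Prop => ∫ z, F (u.1, z) ∂(P.map Z) :=
          hF'.stronglyMeasurable.integral_prod_right
        rw [setIntegral_map ht hsm.aestronglyMeasurable hU.aemeasurable]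
        rfl

theorem ae_mem_of_indep {α γ : Type*} [MeasurableSpace α] [MeasurableSpace γ]
    {Y : Ω → α} {Z : Ω → γ} (hY : Measurable Y) (hZ : Measurable Z) (hind : IndepFun Y Z P)
    {T : Set (α × γ)} (hT : MeasurableSet T) (h : ∀ ω, ∀ᵐ z ∂(P.map Z), (Y ω, z) ∈ T) :
    ∀ᵐ ω ∂P, (Y ω, Z ω) ∈ T := by
  have : IsProbabilityMeasure (P.map Z) := Measure.isProbabilityMeasure_map hZ.aemeasurable
  have hlaw := (indepFun_iff_map_prod_eq_prod_map_map hY.aemeasurable hZ.aemeasurable).1 hind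
  have h1 : ∀ᵐ q ∂((P.map Y).prod (P.map Z)), q ∈ T := by
    rw [Measure.ae_prod_mem_iff_ae_ae_mem hT]
    refine (ae_map_iff hY.aemeasurable ?_).2 (Eventually.of_forall h)
    have : {y | ∀ᵐ z ∂(P.map Z), (y, z) ∈ T} = {y | P.map Z (Prod.mk y ⁻¹' Tᶜ) = 0} := rfl
    rw [this]
    exact (measurable_measure_prodMk_left hT.compl) (measurableSet_singleton 0)
  rw [← hlaw] at h1
  exact ae_of_ae_map (hY.prodMk hZ).aemeasurable h1

end Independence

/-! ### The filtration of past samples -/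

section History

variable {Ω α : Type*} {mΩ : MeasurableSpace Ω} {P : Measure Ω} [IsProbabilityMeasure P]
  [MeasurableSpace α]

/-- The filtration generated at time `k` by an initial value and by the first `k` samples. -/
def historyFiltration (x : Ω → α) (z : ℕ → Ω → α) (hx : Measurable x)
    (hz : ∀ k, Measurable (z k)) : Filtration ℕ mΩ where
  seq k := MeasurableSpace.comap (fun ω => (x ω, fun i : Finset.range k => z i ω)) inferInstance
  mono' j k hjk := by
    have hm : Measurable fun p : α × (Finset.range k → α) =>
        (p.1, fun i : Finset.range j => p.2 ⟨i, Finset.range_mono hjk i.2⟩) := by fun_prop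
    exact (hm.comp (comap_measurable
      (fun ω => (x ω, fun i : Finset.range k => z i ω)))).comap_le
  le' k := (hx.prodMk (measurable_pi_lambda (fun ω (i : Finset.range k) => z i ω) fun i => hz i)).comap_le

theorem measurable_historyFiltration_initial {x : Ω → α} {z : ℕ → Ω → α} (hx : Measurable x)
    (hz : ∀ k, Measurable (z k)) (k : ℕ) : Measurable[historyFiltration x z hx hz k] x :=
  measurable_fst.comp (comap_measurable (fun ω => (x ω, fun i : Finset.range k => z i ω)))

theorem measurable_historyFiltration_sample {x : Ω → α} {z : ℕ → Ω → α} (hx : Measurable x)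
    (hz : ∀ k, Measurable (z k)) {j k : ℕ} (hjk : j < k) :
    Measurable[historyFiltration x z hx hz k] (z j) :=
  ((measurable_pi_apply (⟨j, Finset.mem_range.2 hjk⟩ : Finset.range k)).comp measurable_snd).comp
    (comap_measurable (fun ω => (x ω, fun i : Finset.range k => z i ω)))

/-- The joint law of initial value, past samples and new sample factors in two ways: the initial
value splits from all samples, and the past samples split from the new one. Reassociating the
product gives the claim. -/
theorem indep_historyFiltration {x : Ω → α} {z : ℕ → Ω → α} (hx : Measurable x)
    (hz : ∀ k, Measurable (z k)) (hzind : iIndepFun z P)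
    (hxz : IndepFun x (fun ω k => z k ω) P) (k : ℕ) :
    Indep (historyFiltration x z hx hz k) (MeasurableSpace.comap (z k) inferInstance) P := by
  set Z : Ω → Finset.range k → α := fun ω i => z i ω
  have hZ : Measurable Z := measurable_pi_lambda _ fun i => hz i
  have h1 : IndepFun Z (z k) P := by
    have h := hzind.indepFun_finset (Finset.range k) {k} (by simp) hz
    exact h.comp (φ := id)
      (ψ := fun v : ({k} : Finset ℕ) → α => v ⟨k, Finset.mem_singleton_self k⟩) measurable_id
      (measurable_pi_apply (⟨k, Finset.mem_singleton_self k⟩ : ({k} : Finset ℕ)))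
  have h2 : IndepFun x (fun ω => (Z ω, z k ω)) P := by
    refine hxz.comp (φ := id) (ψ := fun v : ℕ → α => ((fun i : Finset.range k => v i), v k))
      measurable_id (by fun_prop)
  have hZk := hZ.prodMk (hz k)
  have hxZ := hx.prodMk hZ
  have := Measure.isProbabilityMeasure_map (μ := P) hx.aemeasurable
  have := Measure.isProbabilityMeasure_map (μ := P) hZ.aemeasurable
  have := Measure.isProbabilityMeasure_map (μ := P) (hz k).aemeasurable
  have e1 := (indepFun_iff_map_prod_eq_prod_map_map hZ.aemeasurable (hz k).aemeasurable).1 h1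
  have e2 := (indepFun_iff_map_prod_eq_prod_map_map hx.aemeasurable hZk.aemeasurable).1 h2
  have e3 := (indepFun_iff_map_prod_eq_prod_map_map hx.aemeasurable hZ.aemeasurable).1
    (h2.comp (φ := id) (ψ := Prod.fst) measurable_id measurable_fst)
  change IndepFun (fun ω => (x ω, Z ω)) (z k) P
  rw [indepFun_iff_map_prod_eq_prod_map_map hxZ.aemeasurable (hz k).aemeasurable]
  refine (MeasurableEquiv.prodAssoc (α := α) (β := Finset.range k → α)
    (γ := α)).map_measurableEquiv_injective ?_
  rw [e3, Measure.prodAssoc_prod, ← e1, ← e2,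
    Measure.map_map (MeasurableEquiv.measurable _) (hxZ.prodMk (hz k))]
  rfl

end History

/-! ### The projected subgradient process -/

section ProjectedSubgradient

variable {n : ℕ} {Ω : Type*} {mΩ : MeasurableSpace Ω} {P : Measure Ω} [IsProbabilityMeasure P]

local notation "E" => EuclideanSpace ℝ (Fin n)

/-- Distances to a solution converge, and weighted objective gaps are summable, along an adapted
projected subgradient process whose samples are independent of the past. -/
theorem ae_tendsto_norm_sub_and_bddAbove {D X : Set E} {f : E → ℝ} {ε C : ℝ}
    (hD : IsOpen D) (hf : ConvexOn ℝ D f) (hXconvex : Convex ℝ X)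
    (hε : 0 < ε) (hXD : enlargement X ε ⊆ D) (hC : 0 ≤ C)
    (hbdd : ∀ x ∈ enlargement X ε, ∀ g ∈ subdifferential D f x, ‖g‖ ≤ C)
    {γ : ℕ → ℝ} (hγ : ∀ k, 0 < γ k) (hγsq : Summable (fun k => γ k ^ 2))
    {a : E} (ha : IsOptimalSolution X (localSmoothing ε f) a)
    {ℱ : Filtration ℕ mΩ} {y z : ℕ → Ω → E}
    (hym : ∀ k, Measurable[ℱ k] (y k)) (hyX : ∀ k ω, y k ω ∈ X) (hy0 : MemLp (y 0) 2 P)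
    (hz : ∀ k, Measurable (z k)) (hzlaw : ∀ k, P.map (z k) = uniformBall n ε)
    (hind : ∀ k, Indep (ℱ k) (MeasurableSpace.comap (z k) inferInstance) P)
    (hstep : ∀ k ω, IsEuclideanProjection X
      (y k ω - γ k • boundedGradient D f C (y k ω + z k ω)) (y (k + 1) ω)) :
    ∀ᵐ ω ∂P, (∃ l, Tendsto (fun k => ‖y k ω - a‖) atTop (𝓝 l)) ∧
      ∃ B, ∀ k, ∑ i ∈ Finset.range k,
        γ i * (localSmoothing ε f (y i ω) - localSmoothing ε f a) ≤ B := by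
  set G := boundedGradient D f C with hGdef
  set h := localSmoothing ε f with hhdef
  have hym' : ∀ k, Measurable (y k) := fun k => (hym k).mono (ℱ.le k) le_rfl
  have hGm : Measurable G := measurable_boundedGradient hD f C
  have hGC : ∀ p, ‖G p‖ ≤ C := norm_boundedGradient_le hC
  have hLip : LipschitzOnWith C.toNNReal h X :=
    lipschitzOnWith_localSmoothing hD hf hε hXD hC hbdd
  have hyL : ∀ k, MemLp (y k) 2 P := by
    intro k
    induction k with
    | zero => exact hy0
    | succ k ih =>
      -- Since `y k ω` is its own projection, nonexpansiveness bounds the increment by `γ k * C`.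
      have hd : MemLp (fun ω => y (k + 1) ω - y k ω) 2 P := by
        refine MemLp.of_bound ((hym' _).sub (hym' _)).aestronglyMeasurable (γ k * C)
          (Eventually.of_forall fun ω => ?_)
        refine ((hstep k ω).norm_sub_le hXconvex (.self (hyX k ω))).trans ?_
        rw [sub_sub_cancel_left, norm_neg, norm_smul, Real.norm_of_nonneg (hγ k).le]
        exact mul_le_mul_of_nonneg_left (hGC _) (hγ k).le
      have e : y (k + 1) = y k + fun ω => y (k + 1) ω - y k ω := by ext1 ω; simp
      exact e ▸ ih.add hd
  have hyn : ∀ k, MemLp (fun ω => ‖y k ω - a‖) 2 P := fun k => ((hyL k).sub (memLp_const a)).norm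
  have hV : ∀ k, Integrable (fun ω => ‖y k ω - a‖ ^ 2) P := fun k => (hyn k).integrable_sq
  -- Regularity of `h` is known only on `X`; a global Lipschitz extension supplies measurability
  -- along `y`.
  obtain ⟨h', hh', hhh'⟩ := hLip.extend_real
  have hyh : ∀ k, Measurable[ℱ k] fun ω => h (y k ω) := fun k => by
    have : (fun ω => h (y k ω)) = fun ω => h' (y k ω) := funext fun ω => hhh' (hyX k ω)
    rw [this]
    exact hh'.continuous.measurable.comp (hym k)
  have hgap : ∀ k, Integrable (fun ω => h (y k ω) - h a) P := fun k => by
    refine Integrable.mono' (((hyn k).integrable (by norm_num)).const_mul C)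
      (((hyh k).mono (ℱ.le k) le_rfl).sub_const _).aestronglyMeasurable
      (Eventually.of_forall fun ω => ?_)
    rw [Real.norm_of_nonneg (sub_nonneg.2 (ha.2 _ (hyX k ω)))]
    exact localSmoothing_sub_le_mul_norm hD hf hε hXD hC hbdd (hyX k ω) ha.1
  have hinner : ∀ k, Integrable (fun ω => inner ℝ (G (y k ω + z k ω)) (y k ω - a)) P := fun k => by
    refine Integrable.mono' (((hyn k).integrable (by norm_num)).const_mul C)
      ((hGm.comp ((hym' k).add (hz k))).inner ((hym' k).sub_const a)).aestronglyMeasurable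
      (Eventually.of_forall fun ω => ?_)
    exact (norm_inner_le_norm _ _).trans (mul_le_mul_of_nonneg_right (hGC _) (norm_nonneg _))
  have key := ae_tendsto_and_bddAbove_of_setIntegral_le (P := P) (ℱ := ℱ)
    (V := fun k ω => ‖y k ω - a‖ ^ 2) (U := fun k ω => 2 * γ k * (h (y k ω) - h a))
    (β := fun k => C ^ 2 * γ k ^ 2)
    (fun k => ((by fun_prop : Measurable fun v : E => ‖v - a‖ ^ 2).comp (hym k)).stronglyMeasurable)
    (fun k => (((hyh k).sub_const _).const_mul _).stronglyMeasurable)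
    hV (fun k => (hgap k).const_mul _) (fun k ω => by positivity)
    (fun k ω => mul_nonneg (mul_nonneg zero_le_two (hγ k).le) (sub_nonneg.2 (ha.2 _ (hyX k ω))))
    (fun k => by positivity) (hγsq.mul_left _) ?_
  · filter_upwards [key] with ω hω
    obtain ⟨⟨l, hl⟩, B, hB⟩ := hω
    refine ⟨⟨√l, ?_⟩, B / 2, fun k => ?_⟩
    · simpa [Real.sqrt_sq (norm_nonneg _)] using hl.sqrt
    · have h1 : ∑ i ∈ Finset.range k, 2 * γ i * (h (y i ω) - h a)
          = 2 * ∑ i ∈ Finset.range k, γ i * (h (y i ω) - h a) := by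
        rw [Finset.mul_sum]; exact Finset.sum_congr rfl fun i _ => by ring
      linarith [hB k]
  · intro k s hs
    have hpt : ∀ ω, ‖y (k + 1) ω - a‖ ^ 2 ≤ (‖y k ω - a‖ ^ 2 + C ^ 2 * γ k ^ 2)
        - 2 * γ k * inner ℝ (G (y k ω + z k ω)) (y k ω - a) := fun ω => by
      have h1 := (hstep k ω).norm_sub_le hXconvex (.self ha.1)
      have h2 : ‖y (k + 1) ω - a‖ ^ 2
          ≤ ‖(y k ω - a) - γ k • G (y k ω + z k ω)‖ ^ 2 := by
        rw [sub_right_comm]; gcongr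
      rw [norm_sub_sq_real (y k ω - a), inner_smul_right, norm_smul, Real.norm_of_nonneg (hγ k).le,
        real_inner_comm, mul_pow] at h2
      have h3 : ‖G (y k ω + z k ω)‖ ^ 2 ≤ C ^ 2 := by gcongr; exact hGC _
      nlinarith [mul_le_mul_of_nonneg_left h3 (sq_nonneg (γ k))]
    have hVβ : Integrable (fun ω => ‖y k ω - a‖ ^ 2 + C ^ 2 * γ k ^ 2) P :=
      (hV k).add (integrable_const _)
    have hsm := ℱ.le k s hs
    have hcond : ∫ ω in s, (h (y k ω) - h a) ∂P
        ≤ ∫ ω in s, inner ℝ (G (y k ω + z k ω)) (y k ω - a) ∂P := by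
      have e := setIntegral_comp_eq_of_indep (ℱ.le k) (hym k) (hz k) (hind k)
        (measurable_inner_boundedGradient hD f C a) (hinner k) hs
      rw [hzlaw k] at e
      refine le_of_le_of_eq ?_ e.symm
      have hpm := isProbabilityMeasure_uniformBall (n := n) hε
      have hm : StronglyMeasurable fun p : E =>
          ∫ v, inner ℝ (G (p + v)) (p - a) ∂uniformBall n ε :=
        (measurable_inner_boundedGradient hD f C a).stronglyMeasurable.integral_prod_right
      refine setIntegral_mono (hgap k).integrableOn (Integrable.integrableOn ?_) fun ω =>
        localSmoothing_sub_le hD hf hε hXD hC hbdd (hyX k ω) ha.1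
      refine Integrable.mono' (((hyn k).integrable (by norm_num)).const_mul C)
        (hm.measurable.comp (hym' k)).aestronglyMeasurable (Eventually.of_forall fun ω => ?_)
      refine (norm_integral_le_of_norm_le_const (C := C * ‖y k ω - a‖)
        (Eventually.of_forall fun v => ?_)).trans (by simp)
      exact (norm_inner_le_norm _ _).trans (mul_le_mul_of_nonneg_right (hGC _) (norm_nonneg _))
    calc ∫ ω in s, ‖y (k + 1) ω - a‖ ^ 2 ∂P
        ≤ ∫ ω in s, ((‖y k ω - a‖ ^ 2 + C ^ 2 * γ k ^ 2)
            - 2 * γ k * inner ℝ (G (y k ω + z k ω)) (y k ω - a)) ∂P :=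
          setIntegral_mono (hV _).integrableOn
            (hVβ.sub ((hinner k).const_mul _)).integrableOn hpt
      _ = ∫ ω in s, (‖y k ω - a‖ ^ 2 + C ^ 2 * γ k ^ 2) ∂P
            - 2 * γ k * ∫ ω in s, inner ℝ (G (y k ω + z k ω)) (y k ω - a) ∂P := by
          rw [integral_sub hVβ.integrableOn ((hinner k).const_mul _).integrableOn,
            integral_const_mul]
      _ ≤ ∫ ω in s, (‖y k ω - a‖ ^ 2 + C ^ 2 * γ k ^ 2) ∂P
            - 2 * γ k * ∫ ω in s, (h (y k ω) - h a) ∂P := by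
          have := mul_le_mul_of_nonneg_left hcond (mul_nonneg zero_le_two (hγ k).le)
          linarith
      _ = ∫ ω in s, (‖y k ω - a‖ ^ 2 - 2 * γ k * (h (y k ω) - h a) + C ^ 2 * γ k ^ 2) ∂P := by
          rw [← integral_const_mul, ← integral_sub hVβ.integrableOn
            ((hgap k).const_mul _).integrableOn]
          exact integral_congr_ae (Eventually.of_forall fun ω => by ring)

/-- The projected gradient process driven by the samples `z`. -/
noncomputable def projectedProcess (pr G : E → E) (γ : ℕ → ℝ) (x₀ : Ω → E) (z : ℕ → Ω → E) :
    ℕ → Ω → E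
  -- Projecting the initial value keeps the process in `X` for every `ω`, not just almost surely.
  | 0 => fun ω => pr (x₀ ω)
  | k + 1 => fun ω => pr (projectedProcess pr G γ x₀ z k ω
      - γ k • G (projectedProcess pr G γ x₀ z k ω + z k ω))

theorem measurable_projectedProcess {pr G : E → E} (hpr : Measurable pr) (hG : Measurable G)
    {γ : ℕ → ℝ} {x₀ : Ω → E} {z : ℕ → Ω → E} (hx : Measurable x₀) (hz : ∀ k, Measurable (z k))
    (k : ℕ) : Measurable[historyFiltration x₀ z hx hz k] (projectedProcess pr G γ x₀ z k) := by
  induction k with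
  | zero => exact hpr.comp (measurable_historyFiltration_initial hx hz 0)
  | succ k ih =>
    have ih' := ih.mono ((historyFiltration x₀ z hx hz).mono k.le_succ) le_rfl
    exact hpr.comp (ih'.sub ((hG.comp (ih'.add
      (measurable_historyFiltration_sample hx hz k.lt_succ_self))).const_smul (γ k)))

end ProjectedSubgradient

/-! ### Almost sure convergence of the method -/

theorem mainTheorem10 {n : ℕ} {Ω : Type*} [MeasurableSpace Ω] (P : Measure Ω)
    [IsProbabilityMeasure P]
    -- the function, its open convex domain, the constraint set and the smoothing radius
    (D X : Set (EuclideanSpace ℝ (Fin n))) (f : EuclideanSpace ℝ (Fin n) → ℝ) (ε : ℝ)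
    (hD : IsOpen D) (hf : ConvexOn ℝ D f)
    (hXclosed : IsClosed X) (hXconvex : Convex ℝ X)
    (hε : 0 < ε) (hXD : enlargement X ε ⊆ D)
    -- uniformly bounded subgradients on the enlargement
    (C : ℝ) (hC : 0 < C)
    (hbdd : ∀ x ∈ enlargement X ε, ∀ g ∈ subdifferential D f x, ‖g‖ ≤ C)
    -- deterministic stepsizes
    (γ : ℕ → ℝ) (hγ : ∀ k, 0 < γ k) (hγsum : ¬ Summable γ)
    (hγsq : Summable (fun k => γ k ^ 2))
    -- the smoothed problem has a solution
    (hsol : ∃ y, IsOptimalSolution X (localSmoothing ε f) y)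
    -- random initial point, i.i.d. uniform samples independent of it
    (x z g : ℕ → Ω → EuclideanSpace ℝ (Fin n))
    (hx0meas : Measurable (x 0)) (hx0X : ∀ᵐ ω ∂P, x 0 ω ∈ X) (hx0sq : MemLp (x 0) 2 P)
    (hzmeas : ∀ k, Measurable (z k)) (hzlaw : ∀ k, P.map (z k) = uniformBall n ε)
    (hzindep : iIndepFun z P) (hx0indep : IndepFun (x 0) (fun ω k => z k ω) P)
    -- the method
    (hg : ∀ᵐ ω ∂P, ∀ k, g k ω ∈ subdifferential D f (x k ω + z k ω))
    (hstep : ∀ᵐ ω ∂P, ∀ k,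
      IsEuclideanProjection X (x k ω - γ k • g k ω) (x (k + 1) ω)) :
    ∃ xlim : Ω → EuclideanSpace ℝ (Fin n), Measurable xlim ∧
      ∀ᵐ ω ∂P, IsOptimalSolution X (localSmoothing ε f) (xlim ω) ∧
        Tendsto (fun k => x k ω) atTop (𝓝 (xlim ω)) := by
  obtain ⟨a₀, ha₀⟩ := hsol
  choose pr hpr using exists_isEuclideanProjection hXclosed ⟨a₀, ha₀.1⟩
  have hprm : Measurable pr := (LipschitzWith.of_dist_le_mul (K := 1) fun p p' => by
    rw [NNReal.coe_one, one_mul, dist_eq_norm, dist_eq_norm]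
    exact (hpr p).norm_sub_le hXconvex (hpr p')).continuous.measurable
  have hGm := measurable_boundedGradient hD f C
  set y := projectedProcess pr (boundedGradient D f C) γ (x 0) z
  have hym : ∀ k, Measurable[historyFiltration (x 0) z hx0meas hzmeas k] (y k) :=
    measurable_projectedProcess hprm hGm hx0meas hzmeas
  have hym' : ∀ k, Measurable (y k) := fun k => (hym k).mono (Filtration.le _ k) le_rfl
  have hyX : ∀ k ω, y k ω ∈ X := fun k ω => by cases k <;> exact (hpr _).1
  have hy0 : y 0 =ᵐ[P] x 0 := by
    filter_upwards [hx0X] with ω hω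
    exact (hpr _).unique hXconvex (.self hω)
  have hind := indep_historyFiltration hx0meas hzmeas hzindep hx0indep
  have hgood : ∀ᵐ ω ∂P, ∀ k, y k ω + z k ω ∈ boundedGradientPoints D f C := by
    refine ae_all_iff.2 fun k => ?_
    refine ae_mem_of_indep (T := {p | p.1 + p.2 ∈ boundedGradientPoints D f C}) (hym' k) (hzmeas k)
      (indep_of_indep_of_le_left (hind k) (hym k).comap_le)
      ((measurable_fst.add measurable_snd) (measurableSet_boundedGradientPoints hD f C)) fun ω => ?_
    rw [hzlaw k]
    exact ae_add_mem_boundedGradientPoints hD hf hXD hbdd (hyX k ω)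
  have hxy : ∀ᵐ ω ∂P, ∀ k, x k ω = y k ω := by
    filter_upwards [hy0, hgood, hg, hstep] with ω h0 h1 h2 h3 k
    induction k with
    | zero => exact h0.symm
    | succ k ih =>
      have h4 := h3 k
      rw [eq_boundedGradient hD (ih ▸ h1 k) (h2 k), ih] at h4
      exact h4.unique hXconvex (hpr _)
  obtain ⟨S, hSsub, hSc, hSd⟩ := (TopologicalSpace.IsSeparable.of_separableSpace
    {b | IsOptimalSolution X (localSmoothing ε f) b}).exists_countable_dense_subset
  have hlim : ∀ b, IsOptimalSolution X (localSmoothing ε f) b → _ := fun b hb =>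
    ae_tendsto_norm_sub_and_bddAbove hD hf hXconvex hε hXD hC.le hbdd hγ hγsq hb hym hyX
      (hx0sq.ae_eq hy0.symm) hzmeas hzlaw hind fun k ω => hpr _
  have hconv : ∀ᵐ ω ∂P, ∃ b, IsOptimalSolution X (localSmoothing ε f) b ∧
      Tendsto (fun k => y k ω) atTop (𝓝 b) := by
    filter_upwards [hlim a₀ ha₀, (ae_ball_iff hSc).2 fun s hs => hlim s (hSsub hs)] with ω h0 hs
    obtain ⟨-, B, hB⟩ := h0
    exact exists_isOptimalSolution_tendsto hXclosed
      (lipschitzOnWith_localSmoothing hD hf hε hXD hC.le hbdd).continuousOn hγ hγsum ha₀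
      (fun k => hyX k ω) hB (fun b hb => hSd hb) fun s h => (hs s h).1
  -- The measurable limit is taken along `y`, whose terms are measurable, and transferred to `x` by
  -- `hxy`.
  obtain ⟨xlim, hxm, hxlim⟩ := measurable_limit_of_tendsto_metrizable_ae
    (fun k => (hym' k).aemeasurable) (hconv.mono fun ω ⟨b, _, hb⟩ => ⟨b, hb⟩)
  refine ⟨xlim, hxm, ?_⟩
  filter_upwards [hxlim, hconv, hxy] with ω h1 ⟨b, hb, h2⟩ h3
  rw [tendsto_nhds_unique h1 h2]
  exact ⟨hb, by simpa only [h3] using h2⟩
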